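/- Consider the $(a:b)$ Maker--Breaker game on the edge set of $K_n$. In every round first Breaker claims $b$ previously unclaimed edges, and then Maker claims $a$ previously unclaimed edges, one after the other (a player claims all remaining edges if too few are left). Let $d_M(v)$, $d_B(v)$ be the current degrees of the vertex $v$ in Maker's and in Breaker's graph. For a given $k$ call $v$ dangerous if $d_M(v)\le k-1$, and let $\mathcal D(v)=d_B(v)-\frac{2b}{a}d_M(v)$ be its danger. Maker follows the Min-Deg-Strategy: in each of the $a$ steps of each of his moves, as long as there are dangerous vertices, he picks a dangerous vertex whose danger is maximal among the dangerous vertices (ties broken arbitrarily) and claims an arbitrary unclaimed edge incident with it; once there is no dangerous vertex, he claims arbitrary unclaimed edges. Let $0<\delta<\varepsilon<1$ and let $a=a(n)\ge 1$ and $k=k(n)\ge 0$ be integer sequences such that one of the following holds: (i) $a=o\big(\sqrt{n/\ln n}\big)$ and $k=o(\ln n)$; in this case put $\beta(n)=(1-\varepsilon)\frac{an}{a+\ln n}$; (ii) $a=\Omega\big(\sqrt{n/\ln n}\big)$, $k=o(a)$ and $k=o(n)$; in this case put $\beta(n)=(1-\varepsilon)n$. Then there is an $n_0$ such that for all $n\ge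 n_0$ and every integer $b$ with $0\le b\le \beta(n)$ the following holds for every play of the $(a:b)$ game in which Maker follows the Min-Deg-Strategy, whatever Breaker does and however the free choices in the strategy are made. Maker can always carry out his strategy, that is, after Breaker's move and after each step of Maker's move, every dangerous vertex is incident with an unclaimed edge; after at most $\lceil kn/a\rceil$ rounds Maker's graph has minimum degree at least $k$; and throughout the game every vertex whose Maker-degree is less than $k$ has Breaker-degree at most $(1-\delta)n$. -/

import Mathlib

open Filter Asymptotics

namespace MinDegGame

/-- A position of the `(a : b)` game on the edges of the complete graph on `Fin n`:
the edges claimed so far by Maker and by Breaker. -/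
structure Position (n : ℕ) where
  maker : Finset (Sym2 (Fin n))
  breaker : Finset (Sym2 (Fin n))

variable {n : ℕ}

/-- The graph on `Fin n` formed by a set of claimed edges. -/
abbrev graph (E : Finset (Sym2 (Fin n))) : SimpleGraph (Fin n) :=
  SimpleGraph.fromEdgeSet (E : Set (Sym2 (Fin n)))

namespace Position

/-- No edge has been claimed. -/
def init (n : ℕ) : Position n := ⟨∅, ∅⟩

/-- The edges of the complete graph that nobody has claimed. -/
def free (P : Position n) : Finset (Sym2 (Fin n)) :=
  (⊤ : SimpleGraph (Fin n)).edgeFinset \ (P.maker ∪ P.breaker)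

/-- Maker-degree of a vertex. -/
def dM (P : Position n) (v : Fin n) : ℕ := (graph P.maker).degree v

/-- Breaker-degree of a vertex. -/
def dB (P : Position n) (v : Fin n) : ℕ := (graph P.breaker).degree v

/-- A vertex is dangerous if its Maker-degree is below `k`. -/
def Dangerous (k : ℕ) (P : Position n) (v : Fin n) : Prop := P.dM v < k

/-- The danger value `d_B(v) - (2 b / a) d_M(v)`. -/
noncomputable def danger (a b : ℕ) (P : Position n) (v : Fin n) : ℝ :=
  (P.dB v : ℝ) - 2 * (b : ℝ) / (a : ℝ) * (P.dM v : ℝ)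

end Position

/-- A move of Breaker: he claims `b` unclaimed edges (all of them if fewer than `b` are left). -/
def BreakerMove (b : ℕ) (P Q : Position n) : Prop :=
  ∃ S ⊆ P.free, S.card = min b P.free.card ∧ Q = ⟨P.maker, P.breaker ∪ S⟩

/-- One step of a Maker who follows the minimum-degree strategy. While there are dangerous
vertices, he takes one whose danger is largest among the dangerous vertices (ties are broken
arbitrarily) and claims an arbitrary unclaimed edge incident with it. Once there are none, he
claims an arbitrary unclaimed edge, if any is left. -/
def MakerStep (a b k : ℕ) (P Q : Position n) : Prop :=
  (∃ v, P.Dangerous k v ∧ (∀ w, P.Dangerous k w → P.danger a b w ≤ P.danger a b v) ∧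
    ∃ e ∈ P.free, v ∈ e ∧ Q = ⟨insert e P.maker, P.breaker⟩) ∨
  ((∀ v, ¬ P.Dangerous k v) ∧
    ((∃ e ∈ P.free, Q = ⟨insert e P.maker, P.breaker⟩) ∨ (P.free = ∅ ∧ Q = P)))

/-- `Reached a b k r j P`: some play of the `(a : b)` game on the complete graph on `Fin n`, in
which Maker follows the minimum-degree strategy and Breaker plays arbitrarily, passes through `P`
in round `r`, after Breaker's move and exactly `j` of the `a` steps of Maker's move in that round.
Each round starts with Breaker's move. Rounds are numbered from `1`; the initial position counts as
the end of round `0`. Thus `Reached a b k r a P` says that `P` is a position after `r` full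
rounds. -/
inductive Reached (a b k : ℕ) : ℕ → ℕ → Position n → Prop
  | start : Reached a b k 0 a (Position.init n)
  | breaker {r : ℕ} {P Q : Position n} :
      Reached a b k r a P → BreakerMove b P Q → Reached a b k (r + 1) 0 Q
  | maker {r j : ℕ} {P Q : Position n} :
      Reached a b k r j P → j < a → MakerStep a b k P Q → Reached a b k r (j + 1) Q

/-- What the minimum-degree strategy guarantees against every play of Breaker and for all
choices that it leaves open. -/
structure StrategySucceeds (n a b k : ℕ) (δ : ℝ) : Prop where
  /-- Maker is never stuck: each dangerous vertex is incident with an unclaimed edge. -/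
  not_stuck : ∀ (r j : ℕ) (P : Position n), Reached a b k r j P →
    ∀ v, P.Dangerous k v → ∃ e ∈ P.free, v ∈ e
  /-- At the end of round `r`, for every `r ≥ k n / a`, Maker's graph has minimum degree at
  least `k`. -/
  minDegree : ∀ (r : ℕ) (P : Position n), Reached a b k r a P →
    (k : ℝ) * (n : ℝ) / (a : ℝ) ≤ (r : ℝ) → k ≤ (graph P.maker).minDegree
  /-- At all times, vertices of Maker-degree below `k` have Breaker-degree at most
  `(1 - δ) n`. -/
  breaker_degree : ∀ (r j : ℕ) (P : Position n), Reached a b k r j P →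
    ∀ v, P.dM v < k → (P.dB v : ℝ) ≤ (1 - δ) * (n : ℝ)

end MinDegGame

/-! Everything reduces to bounding `dB` at dangerous vertices. Compare the total danger of a set J
of s dangerous vertices, minus c(s) times the number of Breaker edges inside J, with s F(s) plus
what Maker still has to repay of Breaker's last move (`Reached.potential_le`). A Breaker edge adds
at most 2 - c(s) to the left side. A Maker step at a vertex of J lowers it by 2b/a, which repays its
share. A step at v outside J is compared with J ∪ {v} before the step: v has maximal danger, so the
average over J was no larger than that over J ∪ {v}. Since J gives up at most s inner edges to v,
F(s) must exceed F(s + 1) by c(s + 1) plus a term of order b/(as).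

Take c = 1 below a threshold S and c = 0 from S on. Then F(s) - F(s + 1) is b/(as) + 1 for small s
and 2b/(as) for large s. At s = 1 there are no inner edges, so `dB` is at most F(1) + b + 2(b/a)k.
In case (i), S near ηn gives F(1) close to (b/a) ln n, and b + (b/a) ln n ≤ (1 - ε)n. In case (ii),
ln n = o(a) and S = 2 suffices. -/

namespace MinDegGame

/-! ### Degrees and inner edges under added edges -/

section Counting

variable {n : ℕ}

theorem degree_graph (E : Finset (Sym2 (Fin n))) (v : Fin n) :
    (graph E).degree v = (E.filter (fun e => v ∈ e ∧ ¬ e.IsDiag)).card := by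
  classical
  rw [← SimpleGraph.card_incidenceFinset_eq_degree]
  congr 1
  ext e
  simp only [SimpleGraph.mem_incidenceFinset, SimpleGraph.incidenceSet,
    SimpleGraph.edgeSet_fromEdgeSet, Set.mem_sdiff, Finset.mem_coe,
    Finset.mem_filter, Sym2.mem_diagSet, Set.mem_ofPred_eq]
  tauto

theorem degree_graph_insert {E : Finset (Sym2 (Fin n))} {e : Sym2 (Fin n)} (he : e ∉ E)
    (hd : ¬ e.IsDiag) (v : Fin n) :
    (graph (insert e E)).degree v = (graph E).degree v + if v ∈ e then 1 else 0 := by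
  rw [degree_graph, degree_graph, Finset.filter_insert]
  by_cases hv : v ∈ e
  · rw [if_pos ⟨hv, hd⟩, if_pos hv, Finset.card_insert_of_notMem (by simp [he])]
  · rw [if_neg (by tauto), if_neg hv, add_zero]

theorem degree_graph_empty (v : Fin n) : (graph (∅ : Finset (Sym2 (Fin n)))).degree v = 0 := by
  simp [degree_graph]

/-- The number of edges of `E` with both ends in `J`. -/
def innerEdges (E : Finset (Sym2 (Fin n))) (J : Finset (Fin n)) : ℕ :=
  (E.filter (fun e => e ∈ J.sym2 ∧ ¬ e.IsDiag)).card

theorem innerEdges_insert_edge {E : Finset (Sym2 (Fin n))} {e : Sym2 (Fin n)} (he : e ∉ E)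
    (hd : ¬ e.IsDiag) (J : Finset (Fin n)) :
    innerEdges (insert e E) J = innerEdges E J + if e ∈ J.sym2 then 1 else 0 := by
  unfold innerEdges
  rw [Finset.filter_insert]
  by_cases hv : e ∈ J.sym2
  · rw [if_pos ⟨hv, hd⟩, if_pos hv, Finset.card_insert_of_notMem (by simp [he])]
  · rw [if_neg (by tauto), if_neg hv, add_zero]

theorem innerEdges_singleton (E : Finset (Sym2 (Fin n))) (v : Fin n) :
    innerEdges E {v} = 0 := by
  unfold innerEdges
  rw [Finset.card_eq_zero, Finset.filter_eq_empty_iff]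
  rintro e - ⟨h1, h2⟩
  induction e with
  | _ x y =>
    simp only [Finset.mk_mem_sym2_iff, Finset.mem_singleton] at h1
    exact h2 (by simp [h1.1, h1.2])

theorem innerEdges_insert_vertex (E : Finset (Sym2 (Fin n))) (J : Finset (Fin n)) (v : Fin n) :
    innerEdges E (insert v J) ≤ innerEdges E J + J.card := by
  classical
  unfold innerEdges
  calc _ ≤ (E.filter (fun e => e ∈ J.sym2 ∧ ¬ e.IsDiag) ∪ J.image (fun w => s(v, w))).card := by
        apply Finset.card_le_card
        intro e
        induction e with
        | _ x y =>
          simp only [Finset.mem_filter, Finset.mem_union, Finset.mem_image, Finset.mk_mem_sym2_iff,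
            Finset.mem_insert, Sym2.mk_isDiag_iff]
          rintro ⟨hE, ⟨rfl | hx, rfl | hy⟩, hne⟩
          · exact absurd rfl hne
          · exact Or.inr ⟨y, hy, rfl⟩
          · exact Or.inr ⟨x, hx, Sym2.eq_swap⟩
          · exact Or.inl ⟨hE, ⟨hx, hy⟩, hne⟩
    _ ≤ _ := (Finset.card_union_le _ _).trans (Nat.add_le_add_left Finset.card_image_le _)

/-- An edge inside J counts 2 - c. Any other edge meets J at most once and counts at most 1, which
is at most 2 - c. -/
theorem sum_indicator_mem_edge_le (J : Finset (Fin n)) (e : Sym2 (Fin n)) {c : ℝ} (hc : c ≤ 1) :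
    (∑ v ∈ J, if v ∈ e then (1 : ℝ) else 0) - c * (if e ∈ J.sym2 then 1 else 0) ≤ 2 - c := by
  classical
  rw [Finset.sum_boole]
  induction e with
  | _ x y =>
    have h2 : (J.filter (fun v => v ∈ s(x, y))).card ≤ 2 :=
      (Finset.card_le_card (t := {x, y}) (by intro v; simp)).trans Finset.card_le_two
    split_ifs with h
    · have : ((J.filter (fun v => v ∈ s(x, y))).card : ℝ) ≤ 2 := by exact_mod_cast h2
      linarith
    · have h1 : (J.filter (fun v => v ∈ s(x, y))).card ≤ 1 := by
        rw [Finset.mk_mem_sym2_iff] at h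
        rw [Finset.card_le_one]
        intro p hp q hq
        simp only [Finset.mem_filter, Sym2.mem_iff] at hp hq
        grind
      have : ((J.filter (fun v => v ∈ s(x, y))).card : ℝ) ≤ 1 := by exact_mod_cast h1
      linarith

theorem sum_degree_union_le (J : Finset (Fin n)) {c : ℝ} (hc : c ≤ 1)
    (E S : Finset (Sym2 (Fin n))) (hES : ∀ e ∈ S, e ∉ E) (hd : ∀ e ∈ S, ¬ e.IsDiag) :
    (∑ v ∈ J, ((graph (E ∪ S)).degree v : ℝ)) - c * innerEdges (E ∪ S) J ≤
      (∑ v ∈ J, ((graph E).degree v : ℝ)) - c * innerEdges E J + (2 - c) * S.card := by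
  classical
  induction S using Finset.induction_on with
  | empty => rw [Finset.union_empty, Finset.card_empty, Nat.cast_zero, mul_zero, add_zero]
  | insert e S heS ih =>
    have ih := ih (fun x hx => hES x (Finset.mem_insert_of_mem hx))
      (fun x hx => hd x (Finset.mem_insert_of_mem hx))
    have he : e ∉ E ∪ S := by
      simp [heS, hES e (Finset.mem_insert_self e S)]
    have hde := hd e (Finset.mem_insert_self e S)
    have key := sum_indicator_mem_edge_le J e hc
    rw [Finset.union_insert, innerEdges_insert_edge he hde, Finset.card_insert_of_notMem heS]
    simp only [degree_graph_insert he hde]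
    push_cast
    rw [Finset.sum_add_distrib]
    linarith

end Counting

namespace Position

variable {n : ℕ}

theorem mem_free {P : Position n} {e : Sym2 (Fin n)} :
    e ∈ P.free ↔ ¬ e.IsDiag ∧ e ∉ P.maker ∧ e ∉ P.breaker := by
  simp [free]

theorem exists_free_of_degree {P : Position n} {v : Fin n} (h : P.dM v + P.dB v + 1 < n) :
    ∃ e ∈ P.free, v ∈ e := by
  classical
  have hc : ((graph P.maker).neighborFinset v ∪ (graph P.breaker).neighborFinset v ∪ {v}).card
      < (Finset.univ : Finset (Fin n)).card := by
    rw [Finset.card_univ, Fintype.card_fin]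
    refine lt_of_le_of_lt ((Finset.card_union_le _ _).trans
      (Nat.add_le_add_right (Finset.card_union_le _ _) _)) ?_
    simpa [dM, dB] using h
  obtain ⟨w, -, hw⟩ := Finset.exists_mem_notMem_of_card_lt_card hc
  simp only [Finset.mem_union, SimpleGraph.mem_neighborFinset, SimpleGraph.fromEdgeSet_adj,
    Finset.mem_singleton, Finset.mem_coe, not_or] at hw
  refine ⟨s(v, w), mem_free.2 ⟨?_, ?_, ?_⟩, Sym2.mem_mk_left v w⟩
  · simpa using fun h => hw.2 h.symm
  · exact fun h => hw.1.1 ⟨h, fun h => hw.2 h.symm⟩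
  · exact fun h => hw.1.2 ⟨h, fun h => hw.2 h.symm⟩

end Position
end MinDegGame
namespace MinDegGame

/-! ### The potential of a set of dangerous vertices during play -/

section Steps

variable {n : ℕ} {a b k : ℕ}

theorem BreakerMove.dM_eq {P Q : Position n} (h : BreakerMove b P Q) (v : Fin n) :
    Q.dM v = P.dM v := by
  obtain ⟨S, -, -, rfl⟩ := h
  rfl

theorem BreakerMove.sum_dB_le {P Q : Position n} (h : BreakerMove b P Q) (J : Finset (Fin n))
    {c : ℝ} (hc : c ≤ 1) :
    (∑ v ∈ J, (Q.dB v : ℝ)) - c * innerEdges Q.breaker J ≤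
      (∑ v ∈ J, (P.dB v : ℝ)) - c * innerEdges P.breaker J + (2 - c) * b := by
  obtain ⟨S, hS, hcard, rfl⟩ := h
  have h1 := sum_degree_union_le J hc P.breaker S
    (fun e he => (Position.mem_free.1 (hS he)).2.2) (fun e he => (Position.mem_free.1 (hS he)).1)
  have h2 : (S.card : ℝ) ≤ b := by exact_mod_cast hcard.le.trans (min_le_left _ _)
  have h3 : (2 - c) * (S.card : ℝ) ≤ (2 - c) * b :=
    mul_le_mul_of_nonneg_left h2 (by linarith)
  exact h1.trans (by simp only [Position.dB]; linarith)

theorem dM_insert_maker {P : Position n} {e : Sym2 (Fin n)} (he : e ∈ P.free) (w : Fin n) :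
    (Position.mk (insert e P.maker) P.breaker).dM w = P.dM w + if w ∈ e then 1 else 0 :=
  degree_graph_insert (Position.mem_free.1 he).2.1 (Position.mem_free.1 he).1 w

theorem MakerStep.dM_le {P Q : Position n} (h : MakerStep a b k P Q) (v : Fin n) :
    P.dM v ≤ Q.dM v := by
  obtain ⟨u, -, -, e, he, -, rfl⟩ | ⟨-, ⟨e, he, rfl⟩ | ⟨-, rfl⟩⟩ := h
  · rw [dM_insert_maker he]; omega
  · rw [dM_insert_maker he]; omega
  · exact le_rfl

theorem MakerStep.breaker_eq {P Q : Position n} (h : MakerStep a b k P Q) :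
    Q.breaker = P.breaker := by
  obtain ⟨u, -, -, e, he, -, rfl⟩ | ⟨-, ⟨e, he, rfl⟩ | ⟨-, rfl⟩⟩ := h <;> rfl

theorem MakerStep.danger_le {P Q : Position n} (h : MakerStep a b k P Q) (v : Fin n) :
    Q.danger a b v ≤ P.danger a b v := by
  have h1 : (P.dM v : ℝ) ≤ Q.dM v := by exact_mod_cast h.dM_le v
  have h2 : Q.dB v = P.dB v := by unfold Position.dB; rw [h.breaker_eq]
  unfold Position.danger
  rw [h2]
  gcongr

/-- A step of Maker in the presence of dangerous vertices. -/
theorem MakerStep.exists_of_dangerous {P Q : Position n} (h : MakerStep a b k P Q)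
    (hP : ∃ w, P.Dangerous k w) :
    ∃ v, P.Dangerous k v ∧ (∀ w, P.Dangerous k w → P.danger a b w ≤ P.danger a b v) ∧
      Q.dM v = P.dM v + 1 := by
  obtain ⟨u, hu, hmax, e, he, hue, rfl⟩ | ⟨hno, -⟩ := h
  · exact ⟨u, hu, hmax, by rw [dM_insert_maker he, if_pos hue]⟩
  · obtain ⟨w, hw⟩ := hP
    exact absurd hw (hno w)

/-- Used with x the total danger of J, d that of the added vertex, e and e' the inner edges of J and
of the enlarged set, and β, β' the unpaid parts of Breaker's move. Since x ≤ s d, (s + 1) x ≤ s (x +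
d), and the bound for the enlarged set applies to x + d. -/
theorem averaging_step {s x d e e' c c' F F' β β' : ℝ} (hs : 0 < s) (hxd : x ≤ s * d)
    (hc' : 0 ≤ c') (hcc : c' ≤ c) (he : 0 ≤ e) (hee : e' ≤ e + s)
    (hold : x + d - c' * e' ≤ (s + 1) * F' + β')
    (hF : F' + β' / (s + 1) + c' ≤ F + β / s) :
    x - c * e ≤ s * F + β := by
  have hs1 : 0 < s + 1 := by linarith
  have e1 : s * (β / s) = β := by field_simp
  have e2 : (s + 1) * (β' / (s + 1)) = β' := by field_simp
  set y := β / s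
  set y' := β' / (s + 1)
  have h3 : c' * e' ≤ c' * (e + s) := mul_le_mul_of_nonneg_left hee hc'
  have h4 : c' * e ≤ c * e := mul_le_mul_of_nonneg_right hcc he
  have h5 : 0 ≤ c' * s := mul_nonneg hc' hs.le
  have h6 : 0 ≤ c' * e := mul_nonneg hc' he
  have h7 : (s + 1) * (x - c' * e) ≤ (s + 1) * (s * F + β) := by
    have h8 := mul_le_mul_of_nonneg_left hold hs.le
    have h9 := mul_le_mul_of_nonneg_left hF (mul_pos hs1 hs).le
    have h10 := mul_le_mul_of_nonneg_left h3 hs.le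
    rw [← e2] at h8
    rw [← e1]
    nlinarith
  linarith [le_of_mul_le_mul_left h7 hs1]

theorem Reached.potential_le (ha : 1 ≤ a) {c F : ℕ → ℝ} (hc0 : ∀ s, 0 ≤ c s)
    (hc1 : ∀ s, c s ≤ 1) (hc : ∀ s, c (s + 1) ≤ c s) (hF0 : ∀ s, 0 ≤ F s)
    (hF : ∀ s j : ℕ, 1 ≤ s → s < n → j < a →
      F (s + 1) + (2 - c (s + 1)) * b * (1 - (j : ℝ) / a) / ((s : ℝ) + 1) + c (s + 1) ≤
        F s + (2 - c s) * b * (1 - ((j : ℝ) + 1) / a) / s)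
    {r j : ℕ} {P : Position n} (h : Reached a b k r j P) (J : Finset (Fin n))
    (hJ : J.Nonempty) (hdan : ∀ v ∈ J, P.Dangerous k v) :
    (∑ v ∈ J, P.danger a b v) - c J.card * innerEdges P.breaker J ≤
      J.card * F J.card + (2 - c J.card) * b * (1 - (j : ℝ) / a) := by
  classical
  have ha0 : (0 : ℝ) < a := by exact_mod_cast ha
  induction h generalizing J with
  | start =>
    have h1 : ∀ v : Fin n, (Position.init n).danger a b v = 0 := by
      intro v
      have h2 : (Position.init n).dB v = 0 := degree_graph_empty v
      have h3 : (Position.init n).dM v = 0 := degree_graph_empty v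
      simp [Position.danger, h2, h3]
    -- The start counts as step `a` of round 0, so the unpaid part is zero.
    simp only [h1, Finset.sum_const_zero, div_self ha0.ne', sub_self, mul_zero, add_zero]
    have h2 : 0 ≤ c J.card * innerEdges (Position.init n).breaker J :=
      mul_nonneg (hc0 _) (Nat.cast_nonneg _)
    have h3 : 0 ≤ (J.card : ℝ) * F J.card := mul_nonneg (Nat.cast_nonneg _) (hF0 _)
    linarith
  | @breaker r P Q _ hPQ ih =>
    have h1 := ih J hJ (fun v hv => by
      have := hdan v hv
      unfold Position.Dangerous at this ⊢
      rwa [hPQ.dM_eq] at this)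
    have h2 := hPQ.sum_dB_le J (hc1 J.card)
    simp only [Position.danger, Finset.sum_sub_distrib, hPQ.dM_eq] at h1 ⊢
    rw [div_self ha0.ne', sub_self, mul_zero] at h1
    rw [Nat.cast_zero, zero_div, sub_zero, mul_one]
    linarith
  | @maker r j P Q _ hj hPQ ih =>
    have hdanP : ∀ v ∈ J, P.Dangerous k v := fun v hv =>
      lt_of_le_of_lt (hPQ.dM_le v) (hdan v hv)
    obtain ⟨w, hw⟩ := hJ
    obtain ⟨v, hv, hmax, hdeg⟩ := hPQ.exists_of_dangerous ⟨w, hdanP w hw⟩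
    have hb : (0 : ℝ) ≤ (b : ℝ) / a := by positivity
    rw [hPQ.breaker_eq]
    push_cast
    by_cases hvJ : v ∈ J
    · have h1 := ih J ⟨w, hw⟩ hdanP
      have h2 : Q.danger a b v = P.danger a b v - 2 * (b : ℝ) / a := by
        unfold Position.danger Position.dB
        rw [hPQ.breaker_eq, hdeg]
        push_cast
        ring
      have h3 : ∑ u ∈ J, Q.danger a b u ≤ ∑ u ∈ J, P.danger a b u - 2 * (b : ℝ) / a := by
        rw [← Finset.add_sum_erase J _ hvJ, ← Finset.add_sum_erase J (P.danger a b) hvJ, h2]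
        have := Finset.sum_le_sum (s := J.erase v) (fun u _ => hPQ.danger_le u)
        linarith
      -- The step lowers the danger by 2b/a, while the allowance shrinks only by (2 - c)b/a.
      have h4 : (2 - c J.card) * b * (1 - ((j : ℝ) + 1) / a) =
          (2 - c J.card) * b * (1 - (j : ℝ) / a) - 2 * (b : ℝ) / a + c J.card * (b / a) := by
        ring
      have h5 := mul_nonneg (hc0 J.card) hb
      linarith
    · have hlt : J.card < n := by
        have := Finset.card_lt_univ_of_notMem hvJ
        rwa [Fintype.card_fin] at this
      have hpos : 1 ≤ J.card := Finset.card_pos.2 ⟨w, hw⟩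
      have h1 := ih (insert v J) (Finset.insert_nonempty _ _) (by
        intro u hu
        rcases Finset.mem_insert.1 hu with rfl | hu
        · exact hv
        · exact hdanP u hu)
      rw [Finset.card_insert_of_notMem hvJ, Finset.sum_insert hvJ] at h1
      push_cast at h1
      have hsum : ∑ u ∈ J, P.danger a b u ≤ J.card * P.danger a b v := by
        simpa using Finset.sum_le_card_nsmul J _ _ (fun u hu => hmax u (hdanP u hu))
      have hQ : ∑ u ∈ J, Q.danger a b u ≤ ∑ u ∈ J, P.danger a b u :=
        Finset.sum_le_sum (fun u _ => hPQ.danger_le u)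
      have hinner : (innerEdges P.breaker (insert v J) : ℝ) ≤
          innerEdges P.breaker J + J.card := by
        exact_mod_cast innerEdges_insert_vertex P.breaker J v
      have := averaging_step (by exact_mod_cast hpos) hsum (hc0 _) (hc J.card)
        (Nat.cast_nonneg _) hinner (by linarith) (hF J.card j hpos hlt hj)
      linarith

theorem Reached.dB_le (ha : 1 ≤ a) {c F : ℕ → ℝ} (hc0 : ∀ s, 0 ≤ c s)
    (hc1 : ∀ s, c s ≤ 1) (hc : ∀ s, c (s + 1) ≤ c s) (hF0 : ∀ s, 0 ≤ F s)
    (hF : ∀ s j : ℕ, 1 ≤ s → s < n → j < a →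
      F (s + 1) + (2 - c (s + 1)) * b * (1 - (j : ℝ) / a) / ((s : ℝ) + 1) + c (s + 1) ≤
        F s + (2 - c s) * b * (1 - ((j : ℝ) + 1) / a) / s)
    {r j : ℕ} {P : Position n} (h : Reached a b k r j P) {v : Fin n} (hv : P.dM v < k) :
    (P.dB v : ℝ) ≤ F 1 + (2 - c 1) * b + 2 * ((b : ℝ) / a) * k := by
  have h1 := h.potential_le ha hc0 hc1 hc hF0 hF {v} (Finset.singleton_nonempty v)
    (by simpa [Position.Dangerous] using hv)
  rw [innerEdges_singleton, Finset.sum_singleton, Finset.card_singleton] at h1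
  unfold Position.danger at h1
  have ha0 : (0 : ℝ) < a := by exact_mod_cast ha
  have h2 : (2 - c 1) * b * (1 - (j : ℝ) / a) ≤ (2 - c 1) * b := by
    apply mul_le_of_le_one_right
    · exact mul_nonneg (by linarith [hc1 1]) (Nat.cast_nonneg _)
    · have : (0 : ℝ) ≤ (j : ℝ) / a := by positivity
      linarith
  have h3 : 2 * (b : ℝ) / a * P.dM v ≤ 2 * ((b : ℝ) / a) * k := by
    rw [mul_div_assoc]
    gcongr
  simp only [Nat.cast_zero, mul_zero, sub_zero, Nat.cast_one, one_mul] at h1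
  linarith

/-- While a dangerous vertex exists, each Maker step raises the sum of degrees truncated at `k`. The
summand `a` offsets the start, which is numbered as step `a` of round 0. -/
theorem Reached.steps_le {r j : ℕ} {P : Position n} (h : Reached a b k r j P) :
    (∀ v, k ≤ P.dM v) ∨ r * a + j ≤ (∑ v, min (P.dM v) k) + a := by
  induction h with
  | start => right; omega
  | @breaker r P Q _ hPQ ih =>
    simp only [hPQ.dM_eq]
    refine ih.imp_right (fun h => ?_)
    rw [Nat.succ_mul]
    omega
  | @maker r j P Q _ hj hPQ ih =>
    by_cases hP : ∃ w, P.Dangerous k w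
    · right
      have ih : r * a + j ≤ (∑ v, min (P.dM v) k) + a := by
        refine ih.resolve_left (fun h => ?_)
        obtain ⟨w, hw⟩ := hP
        exact absurd hw (not_lt.2 (h w))
      obtain ⟨v, hv, -, hdeg⟩ := hPQ.exists_of_dangerous hP
      have : ∑ v, min (P.dM v) k < ∑ v, min (Q.dM v) k := by
        refine Finset.sum_lt_sum (fun u _ => ?_) ⟨v, Finset.mem_univ v, ?_⟩
        · have := hPQ.dM_le u
          omega
        · unfold Position.Dangerous at hv
          omega
      omega
    · left
      intro v
      exact (not_lt.1 (fun h => hP ⟨v, h⟩)).trans (hPQ.dM_le v)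

theorem Reached.le_dM {r : ℕ} {P : Position n} (h : Reached a b k r a P)
    (hr : k * n ≤ r * a) (v : Fin n) : k ≤ P.dM v := by
  by_contra hv
  rcases h.steps_le with h | h
  · exact hv (h v)
  · have : ∑ v, min (P.dM v) k < ∑ _v : Fin n, k :=
      Finset.sum_lt_sum (fun u _ => min_le_right _ _) ⟨v, Finset.mem_univ v, by omega⟩
    rw [Finset.sum_const, Finset.card_univ, Fintype.card_fin, smul_eq_mul, mul_comm] at this
    omega

/-- It suffices to bound the Breaker-degrees of the dangerous vertices. -/
theorem strategySucceeds_of_dB_le {δ : ℝ} (hn : 0 < n) (ha : 1 ≤ a) (hk : (k : ℝ) < δ * n)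
    (h : ∀ (r j : ℕ) (P : Position n), Reached a b k r j P →
      ∀ v, P.dM v < k → (P.dB v : ℝ) ≤ (1 - δ) * n) :
    StrategySucceeds n a b k δ where
  not_stuck r j P hP v hv := by
    -- The Maker-degree plus one is at most k < δn, which fits beside (1 - δ)n Breaker edges.
    apply Position.exists_free_of_degree
    have h1 := h r j P hP v hv
    have h2 : (P.dM v : ℝ) + 1 ≤ k := by exact_mod_cast hv
    have h3 : (P.dM v : ℝ) + P.dB v + 1 < n := by linarith
    exact_mod_cast h3
  minDegree r P hP hr := by
    have : Nonempty (Fin n) := ⟨⟨0, hn⟩⟩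
    have ha0 : (0 : ℝ) < a := by exact_mod_cast ha
    rw [div_le_iff₀ ha0] at hr
    exact SimpleGraph.le_minDegree_of_forall_le_degree _ _ (hP.le_dM (by exact_mod_cast hr))
  breaker_degree := h

end Steps

end MinDegGame
namespace MinDegGame

/-! ### Choice of discount and bound, and their estimates -/

section Bounds

variable {n : ℕ} {a b k : ℕ}

/-- The factor with which inner Breaker edges are discounted for sets of a given size. -/
noncomputable def discount (S s : ℕ) : ℝ := if s < S then 1 else 0

/-- The loss in the bound for the average danger beyond `b / (a u)`, when the size of the set
under consideration grows from `u` to `u + 1`. -/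
noncomputable def extraLoss (a b S u : ℕ) : ℝ :=
  if u + 1 < S then 1
  else if u + 1 = S then b * ((u : ℝ) - 1) / (u * ((u : ℝ) + 1))
  else (b : ℝ) / a / u

/-- The bound for the average danger of a set of `s` dangerous vertices. -/
noncomputable def dangerBound (n a b S s : ℕ) : ℝ :=
  ∑ u ∈ Finset.Ico s n, ((b : ℝ) / a / u + extraLoss a b S u)

theorem extraLoss_nonneg (a b S u : ℕ) : 0 ≤ extraLoss a b S u := by
  unfold extraLoss
  split_ifs
  · norm_num
  · rcases Nat.eq_zero_or_pos u with rfl | hu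
    · simp
    · have : (1 : ℝ) ≤ u := by exact_mod_cast hu
      have : (0 : ℝ) ≤ (u : ℝ) - 1 := by linarith
      positivity
  · positivity

theorem dangerBound_nonneg (n a b S s : ℕ) : 0 ≤ dangerBound n a b S s :=
  Finset.sum_nonneg fun u _ => add_nonneg (by positivity) (extraLoss_nonneg a b S u)

/-- The term b/(as) pays for the one step by which the two allowances differ. `extraLoss` pays for
the rest: the new inner edges below S, the jump of 2 - c from 1 to 2 at S, and a second b/(as) above
S. -/
theorem dangerBound_step {S s j : ℕ} (hs : 1 ≤ s) (hsn : s < n) (hj : j < a) :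
    dangerBound n a b S (s + 1) +
        (2 - discount S (s + 1)) * b * (1 - (j : ℝ) / a) / ((s : ℝ) + 1) + discount S (s + 1) ≤
      dangerBound n a b S s + (2 - discount S s) * b * (1 - ((j : ℝ) + 1) / a) / s := by
  have hs0 : (1 : ℝ) ≤ s := by exact_mod_cast hs
  have ha0 : (0 : ℝ) < a := by exact_mod_cast (Nat.zero_le j).trans_lt hj
  have hX0 : 0 ≤ 1 - (j : ℝ) / a := by
    rw [sub_nonneg, div_le_one ha0]
    exact_mod_cast hj.le
  have hX1 : 1 - (j : ℝ) / a ≤ 1 := by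
    have : (0 : ℝ) ≤ (j : ℝ) / a := by positivity
    linarith
  have hXa : 1 - ((j : ℝ) + 1) / a = 1 - (j : ℝ) / a - 1 / a := by ring
  rw [hXa]
  have hb : (0 : ℝ) ≤ b := Nat.cast_nonneg b
  set X := 1 - (j : ℝ) / a
  have hmono : b * X / ((s : ℝ) + 1) ≤ b * X / s := by
    apply div_le_div_of_nonneg_left (by positivity) (by linarith) (by linarith)
  have hF : dangerBound n a b S s =
      (b : ℝ) / a / s + extraLoss a b S s + dangerBound n a b S (s + 1) :=
    Finset.sum_eq_sum_Ico_succ_bot hsn _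
  rw [hF]
  unfold discount extraLoss
  rcases lt_trichotomy (s + 1) S with h | h | h
  · rw [if_pos h, if_pos h, if_pos (by omega)]
    have e : (2 - 1) * (b : ℝ) * (X - 1 / a) / s = b * X / s - b / a / s := by ring
    have e' : (2 - 1) * (b : ℝ) * X / ((s : ℝ) + 1) = b * X / ((s : ℝ) + 1) := by ring
    rw [e, e']
    linarith
  · rw [if_neg h.not_lt, if_neg h.not_lt, if_pos h, if_pos (by omega)]
    have e : (2 - 1) * (b : ℝ) * (X - 1 / a) / s = b * X / s - b / a / s := by ring
    -- The jump costs 2/(s + 1) - 1/s = (s - 1)/(s(s + 1)), which vanishes at s = 1.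
    have e' : (2 - 0) * (b : ℝ) * X / ((s : ℝ) + 1) =
        b * X / s + X * (b * ((s : ℝ) - 1) / (s * ((s : ℝ) + 1))) := by
      field_simp
      ring
    have h1 : 0 ≤ b * ((s : ℝ) - 1) / (s * ((s : ℝ) + 1)) := by
      have : (0 : ℝ) ≤ (s : ℝ) - 1 := by linarith
      positivity
    have h2 := mul_le_of_le_one_left h1 hX1
    rw [e, e']
    linarith
  · rw [if_neg h.not_gt, if_neg h.not_gt, if_neg h.ne', if_neg (by omega)]
    have e : (2 - 0) * (b : ℝ) * (X - 1 / a) / s = 2 * (b * X / s) - 2 * (b / a / s) := by ring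
    have e' : (2 - 0) * (b : ℝ) * X / ((s : ℝ) + 1) = 2 * (b * X / ((s : ℝ) + 1)) := by ring
    rw [e, e']
    linarith

theorem Reached.dB_le_dangerBound (ha : 1 ≤ a) {S : ℕ} (hS : 2 ≤ S) {r j : ℕ} {P : Position n}
    (h : Reached a b k r j P) {v : Fin n} (hv : P.dM v < k) :
    (P.dB v : ℝ) ≤ dangerBound n a b S 1 + b + 2 * ((b : ℝ) / a) * k := by
  have h1 := h.dB_le (c := discount S) (F := dangerBound n a b S) ha
    (fun s => by unfold discount; split_ifs <;> norm_num)
    (fun s => by unfold discount; split_ifs <;> norm_num)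
    (fun s => by
      unfold discount
      split_ifs
      · norm_num
      · omega
      · norm_num
      · norm_num)
    (dangerBound_nonneg n a b S) (fun s j hs hsn hj => dangerBound_step hs hsn hj) hv
  -- The discount is free for a singleton, and Breaker's current move then costs b instead of 2b.
  have h2 : discount S 1 = 1 := if_pos (by omega)
  rw [h2] at h1
  linarith

theorem sum_Ico_div_le {x : ℝ} (hx : 0 ≤ x) (n : ℕ) :
    ∑ u ∈ Finset.Ico 1 n, x / u ≤ x * (1 + Real.log n) := by
  have h1 : ∑ u ∈ Finset.Ico 1 n, (u : ℝ)⁻¹ ≤ (harmonic n : ℝ) := by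
    rw [harmonic_eq_sum_Icc]
    push_cast
    exact Finset.sum_le_sum_of_subset_of_nonneg Finset.Ico_subset_Icc_self
      (fun _ _ _ => by positivity)
  simp only [div_eq_mul_inv, ← Finset.mul_sum]
  exact mul_le_mul_of_nonneg_left (h1.trans (harmonic_le_one_add_log n)) hx

theorem dangerBound_two_le (n a b : ℕ) :
    dangerBound n a b 2 1 ≤ 2 * ((b : ℝ) / a) * (1 + Real.log n) := by
  have h : dangerBound n a b 2 1 ≤ ∑ u ∈ Finset.Ico 1 n, (2 * ((b : ℝ) / a)) / u := by
    apply Finset.sum_le_sum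
    intro u hu
    have hu := (Finset.mem_Ico.1 hu).1
    have h0 : (0 : ℝ) ≤ b / a / u := by positivity
    have h1 : extraLoss a b 2 u ≤ b / a / u := by
      unfold extraLoss
      split_ifs with h1 h2
      · omega
      · obtain rfl : u = 1 := by omega
        simpa using h0
      · exact le_rfl
    rw [mul_div_assoc]
    linarith
  exact h.trans (sum_Ico_div_le (by positivity) n)

/-- The extra losses are at most S in total below the threshold, b/S at it, and b/(aS) for each
larger size. A linear S thus keeps the coefficient of the logarithm at b/a instead of 2b/a. -/
theorem dangerBound_le (n a b : ℕ) {S : ℕ} (hS : 2 ≤ S) :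
    dangerBound n a b S 1 ≤
      (b : ℝ) / a * (1 + Real.log n) + (S + b / S + n * ((b : ℝ) / a / S)) := by
  have hS0 : (0 : ℝ) < S := by exact_mod_cast (by omega : 0 < S)
  unfold dangerBound
  rw [Finset.sum_add_distrib]
  refine add_le_add (sum_Ico_div_le (by positivity) n) ?_
  calc ∑ u ∈ Finset.Ico 1 n, extraLoss a b S u
      ≤ ∑ u ∈ Finset.Ico 1 n, ((if u ∈ Finset.range S then (1 : ℝ) else 0) +
          (if S - 1 = u then (b : ℝ) / S else 0) + (b : ℝ) / a / S) := by
        apply Finset.sum_le_sum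
        intro u hu
        have hu := (Finset.mem_Ico.1 hu).1
        have hu0 : (1 : ℝ) ≤ u := by exact_mod_cast hu
        have h0 : (0 : ℝ) ≤ (b : ℝ) / S := by positivity
        have h1 : (0 : ℝ) ≤ (b : ℝ) / a / S := by positivity
        have h2 : (0 : ℝ) ≤ (if S - 1 = u then (b : ℝ) / S else 0) := by
          split_ifs
          · exact h0
          · exact le_rfl
        have h3 : (0 : ℝ) ≤ (if u ∈ Finset.range S then (1 : ℝ) else 0) := by
          split_ifs <;> norm_num
        rcases lt_trichotomy (u + 1) S with h | h | h
        · rw [extraLoss, if_pos h, if_pos (Finset.mem_range.2 (by omega))]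
          linarith
        · rw [extraLoss, if_neg h.not_lt, if_pos h, if_pos (show S - 1 = u by omega)]
          have h4 : (b : ℝ) * ((u : ℝ) - 1) / (u * ((u : ℝ) + 1)) ≤ b / S := by
            have hSu : (S : ℝ) = u + 1 := by exact_mod_cast h.symm
            rw [hSu, div_le_div_iff₀ (by positivity) (by positivity), mul_assoc]
            apply mul_le_mul_of_nonneg_left _ (Nat.cast_nonneg b)
            nlinarith
          linarith
        · rw [extraLoss, if_neg h.not_gt, if_neg h.ne']
          have h4 : (b : ℝ) / a / u ≤ b / a / S :=
            div_le_div_of_nonneg_left (by positivity) hS0 (by exact_mod_cast (by omega : S ≤ u))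
          linarith
    _ ≤ _ := by
        rw [Finset.sum_add_distrib, Finset.sum_add_distrib]
        refine add_le_add (add_le_add ?_ ?_) ?_
        · rw [Finset.sum_ite_mem, Finset.sum_const, nsmul_eq_mul, mul_one]
          exact_mod_cast (Finset.card_le_card Finset.inter_subset_right).trans
            (Finset.card_range S).le
        · rw [Finset.sum_ite_eq]
          split_ifs
          · exact le_rfl
          · positivity
        · rw [Finset.sum_const, nsmul_eq_mul, Nat.card_Ico]
          have : ((n - 1 : ℕ) : ℝ) ≤ n := by exact_mod_cast Nat.sub_le n 1
          gcongr

end Bounds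

/-! ### The two regimes and the limit -/

theorem strategySucceeds_of_sublog {ε δ η : ℝ} {n a b k : ℕ} (hε : 0 < ε) (hη : 0 < η)
    (hηε : δ + 4 * η ≤ ε) (ha : 1 ≤ a) (hlog : 0 < Real.log n)
    (hk : (k : ℝ) < δ * n) (hkL : (k : ℝ) ≤ η / 2 * Real.log n)
    (hL : 1 + 1 / η ≤ η * Real.log n) (hn : 3 + 1 / η ≤ η * n)
    (hb : (b : ℝ) ≤ (1 - ε) * ((a : ℝ) * n / (a + Real.log n))) :
    StrategySucceeds n a b k δ := by
  have hn0 : 0 < n := by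
    rcases Nat.eq_zero_or_pos n with rfl | h
    · simp at hlog
    · exact h
  refine strategySucceeds_of_dB_le hn0 ha hk (fun r j P hP v hv => ?_)
  set L := Real.log n
  have hnR : (0 : ℝ) < n := by exact_mod_cast hn0
  have ha0 : (0 : ℝ) < a := by exact_mod_cast ha
  -- The losses total 4ηn: ηn from S, ηn from its rounding together with b/S, ηn from (b/a)(1 +
  -- 1/η), and ηn from 2(b/a)k.
  set S := ⌈η * n⌉₊ + 2 with hSdef
  have hS2 : 2 ≤ S := by omega
  have hS1 : η * n ≤ S := by
    have := Nat.le_ceil (η * n)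
    rw [hSdef]
    push_cast
    linarith
  have hS3 : (S : ℝ) ≤ η * n + 3 := by
    have := Nat.ceil_lt_add_one (show 0 ≤ η * n by positivity)
    rw [hSdef]
    push_cast
    linarith
  set q : ℝ := (b : ℝ) / a with hq
  have hq0 : 0 ≤ q := by positivity
  have hbq : (b : ℝ) = a * q := by rw [hq]; field_simp
  have hmain : b + q * L ≤ (1 - ε) * n := by
    have h1 : (b : ℝ) + q * L = b * ((a + L) / a) := by rw [hq]; field_simp
    rw [h1]
    calc (b : ℝ) * ((a + L) / a) ≤ (1 - ε) * ((a : ℝ) * n / (a + L)) * ((a + L) / a) := by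
          gcongr
      _ = (1 - ε) * n := by field_simp
  have hεn : 0 ≤ ε * n := by positivity
  have hqL : q * L ≤ n := by linarith [Nat.cast_nonneg (α := ℝ) b]
  have hbn : (b : ℝ) ≤ n := by linarith [mul_nonneg hq0 hlog.le]
  have hbS : (b : ℝ) / S ≤ 1 / η := by
    calc (b : ℝ) / S ≤ n / (η * n) := by gcongr
      _ = 1 / η := by field_simp
  have hqS : n * (q / S) ≤ q * (1 / η) := by
    calc n * (q / S) ≤ n * (q / (η * n)) := by gcongr
      _ = q * (1 / η) := by field_simp
  have hq1 : q * (1 + 1 / η) ≤ η * n := by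
    calc q * (1 + 1 / η) ≤ q * (η * L) := by gcongr
      _ = η * (q * L) := by ring
      _ ≤ η * n := by gcongr
  have hqk : 2 * q * k ≤ η * n := by
    calc 2 * q * k ≤ 2 * q * (η / 2 * L) := by gcongr
      _ = η * (q * L) := by ring
      _ ≤ η * n := by gcongr
  have h1 := hP.dB_le_dangerBound ha hS2 hv
  have h2 := dangerBound_le n a b hS2
  have h3 : (δ + 4 * η) * n ≤ ε * n := by gcongr
  linarith

/-- With S = 2 the terms 2(b/a)(1 + ln n) and 2(b/a)k each cost at most 2ηn, so doubling the
logarithm is harmless. -/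
theorem strategySucceeds_of_large {ε δ η : ℝ} {n a b k : ℕ} (hε : 0 < ε) (hη : 0 < η)
    (hηε : δ + 4 * η ≤ ε) (ha : 1 ≤ a) (hn0 : 0 < n)
    (hk : (k : ℝ) < δ * n) (hka : (k : ℝ) ≤ η * a) (hL : 1 + Real.log n ≤ η * a)
    (hb : (b : ℝ) ≤ (1 - ε) * n) :
    StrategySucceeds n a b k δ := by
  refine strategySucceeds_of_dB_le hn0 ha hk (fun r j P hP v hv => ?_)
  have hnR : (0 : ℝ) < n := by exact_mod_cast hn0
  have ha0 : (0 : ℝ) < a := by exact_mod_cast ha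
  have hεn : 0 ≤ ε * n := by positivity
  have hbn : (b : ℝ) ≤ n := by linarith
  have hq : (b : ℝ) / a * (η * a) ≤ η * n := by
    calc (b : ℝ) / a * (η * a) = η * b := by field_simp
      _ ≤ η * n := by gcongr
  have hqL : (b : ℝ) / a * (1 + Real.log n) ≤ (b : ℝ) / a * (η * a) := by gcongr
  have hqk : (b : ℝ) / a * k ≤ (b : ℝ) / a * (η * a) := by gcongr
  have h1 := hP.dB_le_dangerBound ha le_rfl hv
  have h2 := dangerBound_two_le n a b
  have h3 : (δ + 4 * η) * n ≤ ε * n := by gcongr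
  linarith

/-- After squaring, this is (ln n)³ = o(n). It turns the lower bound on `a` in case (ii) into ln n =
o(a). -/
theorem one_add_log_isLittleO :
    (fun n : ℕ => 1 + Real.log n) =o[atTop] (fun n : ℕ => Real.sqrt ((n : ℝ) / Real.log n)) := by
  rw [isLittleO_iff]
  intro c hc
  have hlog : Tendsto (fun n : ℕ => Real.log (n : ℝ)) atTop atTop :=
    Real.tendsto_log_atTop.comp tendsto_natCast_atTop_atTop
  have hpow : ∀ᶠ n : ℕ in atTop, ‖Real.log (n : ℝ) ^ 3‖ ≤ c ^ 2 / 4 * ‖(n : ℝ)‖ :=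
    (Real.isLittleO_pow_log_id_atTop.comp_tendsto tendsto_natCast_atTop_atTop).bound (by positivity)
  filter_upwards [hpow, hlog.eventually_ge_atTop 1] with n h3 h1
  have h0 : 0 < Real.log (n : ℝ) := by linarith
  rw [Real.norm_of_nonneg (by positivity), Real.norm_of_nonneg (by positivity)] at h3
  rw [Real.norm_of_nonneg (by positivity), Real.norm_of_nonneg (by positivity)]
  have e : c * Real.sqrt ((n : ℝ) / Real.log n) = Real.sqrt (c ^ 2 * ((n : ℝ) / Real.log n)) := by
    rw [Real.sqrt_mul (by positivity), Real.sqrt_sq hc.le]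
  rw [e]
  apply Real.le_sqrt_of_sq_le
  rw [← mul_div_assoc, le_div_iff₀ h0]
  set L := Real.log (n : ℝ)
  calc (1 + L) ^ 2 * L ≤ (L + L) ^ 2 * L := by gcongr
    _ = 4 * L ^ 3 := by ring
    _ ≤ c ^ 2 * n := by linarith

end MinDegGame

theorem mainTheorem6 (ε δ : ℝ) (hδ : 0 < δ) (hδε : δ < ε) (hε : ε < 1)
    (a k : ℕ → ℕ) (ha : ∀ n, 1 ≤ a n) :
    ((fun n : ℕ => (a n : ℝ)) =o[atTop] (fun n : ℕ => Real.sqrt ((n : ℝ) / Real.log (n : ℝ))) →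
      (fun n : ℕ => (k n : ℝ)) =o[atTop] (fun n : ℕ => Real.log (n : ℝ)) →
      ∃ n₀ : ℕ, ∀ n ≥ n₀, ∀ b : ℕ,
        (b : ℝ) ≤ (1 - ε) * ((a n : ℝ) * (n : ℝ) / ((a n : ℝ) + Real.log (n : ℝ))) →
        MinDegGame.StrategySucceeds n (a n) b (k n) δ) ∧
    ((fun n : ℕ => Real.sqrt ((n : ℝ) / Real.log (n : ℝ))) =O[atTop] (fun n : ℕ => (a n : ℝ)) →
      (fun n : ℕ => (k n : ℝ)) =o[atTop] (fun n : ℕ => (a n : ℝ)) →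
      (fun n : ℕ => (k n : ℝ)) =o[atTop] (fun n : ℕ => (n : ℝ)) →
      ∃ n₀ : ℕ, ∀ n ≥ n₀, ∀ b : ℕ,
        (b : ℝ) ≤ (1 - ε) * (n : ℝ) →
        MinDegGame.StrategySucceeds n (a n) b (k n) δ) := by
  -- Both regimes lose 4ηn in total, exactly the gap between (1 - ε)n and (1 - δ)n.
  set η : ℝ := (ε - δ) / 4 with hηdef
  have hη : 0 < η := by rw [hηdef]; linarith
  have hηε : δ + 4 * η ≤ ε := by rw [hηdef]; linarith
  have hε0 : 0 < ε := hδ.trans hδε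
  have hcast : Tendsto (fun n : ℕ => (n : ℝ)) atTop atTop := tendsto_natCast_atTop_atTop
  have hlog : Tendsto (fun n : ℕ => Real.log (n : ℝ)) atTop atTop :=
    Real.tendsto_log_atTop.comp hcast
  have hsmall : (fun n : ℕ => (k n : ℝ)) =o[atTop] (fun n : ℕ => (n : ℝ)) →
      ∀ᶠ n : ℕ in atTop, (k n : ℝ) < δ * n := by
    intro h
    filter_upwards [h.bound (half_pos hδ), eventually_gt_atTop 0] with n hn h0
    have h0 : (0 : ℝ) < n := by exact_mod_cast h0
    rw [Real.norm_natCast, Real.norm_natCast] at hn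
    nlinarith [mul_pos hδ h0]
  constructor
  · intro _ hk
    have hkn : (fun n : ℕ => (k n : ℝ)) =o[atTop] (fun n : ℕ => (n : ℝ)) :=
      hk.trans (Real.isLittleO_log_id_atTop.comp_tendsto hcast)
    refine eventually_atTop.1 ?_
    filter_upwards [hsmall hkn, hk.bound (half_pos hη), hlog.eventually_gt_atTop 0,
      (hlog.const_mul_atTop hη).eventually_ge_atTop (1 + 1 / η),
      (hcast.const_mul_atTop hη).eventually_ge_atTop (3 + 1 / η)] with n h1 h2 h3 h4 h5 b hb
    rw [Real.norm_natCast, Real.norm_of_nonneg h3.le] at h2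
    exact MinDegGame.strategySucceeds_of_sublog hε0 hη hηε (ha n) h3 h1 h2 h4 h5 hb
  · intro hla hka hkn
    refine eventually_atTop.1 ?_
    filter_upwards [hsmall hkn, hka.bound hη,
      (MinDegGame.one_add_log_isLittleO.trans_isBigO hla).bound hη,
      eventually_gt_atTop 0] with n h1 h2 h3 h4 b hb
    rw [Real.norm_natCast, Real.norm_natCast] at h2
    rw [Real.norm_natCast] at h3
    exact MinDegGame.strategySucceeds_of_large hε0 hη hηε (ha n) h4 h1 h2
      ((Real.le_norm_self _).trans h3) hb
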